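/- Consider sequences of fractions, i.e. functions $f:\mathbb{N}\to\mathbb{Z}\times\mathbb{N}^{>0}$, where the value $f(k)=(a_k,b_k)$ stands for the fraction $a_k/b_k$. Such a sequence is \emph{convergent} if for all $m\in\mathbb{N}$ there is $n\in\mathbb{N}$ such that for all $k_1,k_2>n$ we have $m\,|a_{k_1}b_{k_2}-a_{k_2}b_{k_1}|<b_{k_1}b_{k_2}$. An \emph{$\mathbb{N}$-real} is a convergent $f$ whose graph $\{(k,a,b): f(k)=(a,b)\}$ (with integers coded by natural numbers in a standard way) is definable in $(\mathbb{N},0,1,+,\cdot,<)$ by a first-order formula with finitely many parameters from $\mathbb{N}$. Two $\mathbb{N}$-reals $(a_k,b_k)_k$ and $(c_k,d_k)_k$ are equivalent if for all $m$ there is $n$ such that $m\,|a_kd_k-b_kc_k|<b_kd_k$ for all $k>n$. Let $K_{\mathbb{N}}$ be the set of equivalence classes of $\mathbb{N}$-reals; for a sequence of fractions $Y$ we write $Y\in K_{\mathbb{N}}$ if $Y$ is an $\mathbb{N}$-real (and so represents an element of $K_{\mathbb{N}}$). As an oracle, a sequence of fractions is regarded as a function $\mathbb{N}\to\mathbb{N}$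 by coding pairs $(a,b)$ by natural numbers. Theorem. (1) Let $n\in\mathbb{N}$, let $X_1,\dots,X_n\in K_{\mathbb{N}}$ be represented by arbitrary $\mathbb{N}$-reals $x_1,\dots,x_n$, and let $Y:\mathbb{N}\to\mathbb{Z}\times\mathbb{N}^{>0}$. If $Y$ is recursive in $x_1,\dots,x_n$ and convergent, then $Y\in K_{\mathbb{N}}$. (2) $K_{\mathbb{N}}$ is closed under the Turing jump: if $Y:\mathbb{N}\to\mathbb{Z}\times\mathbb{N}^{>0}$ satisfies $Y\in K_{\mathbb{N}}$, then $Y^{(n)}\in K_{\mathbb{N}}$ for every $n\in\mathbb{N}$. Here $Y^{(0)}=Y$ and, for $n>0$, $Y^{(n)}\subseteq\mathbb{N}$ is the $n$-th iterated Turing jump of $Y$, identified with the real number $\sum_{i\in Y^{(n)}}2^{-i-1}$, that is, with the sequence of the partial sums $\sum_{i<k,\ i\in Y^{(n)}}2^{-i-1}$ $(k\in\mathbb{N})$, the $k$-th written with denominator $2^k$. -/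

import Mathlib

/-! ## The language of Peano arithmetic and its standard model -/

/-- Function symbols `0, 1, +, ·` of the language of Peano arithmetic. -/
inductive PAFunc : ℕ → Type
  | zero : PAFunc 0
  | one : PAFunc 0
  | add : PAFunc 2
  | mul : PAFunc 2

/-- The only relation symbol `<` of the language of Peano arithmetic. -/
inductive PARel : ℕ → Type
  | lt : PARel 2

/-- The first-order language `{0, 1, +, ·, <}` of Peano arithmetic. -/
def languagePA : FirstOrder.Language.{0, 0} where
  Functions := PAFunc
  Relations := PARel

/-- The standard model of arithmetic. -/
instance standardModel : languagePA.Structure ℕ where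
  funMap {_} f v :=
    match f, v with
    | PAFunc.zero, _ => 0
    | PAFunc.one, _ => 1
    | PAFunc.add, v => v 0 + v 1
    | PAFunc.mul, v => v 0 * v 1
  RelMap {_} r v :=
    match r, v with
    | PARel.lt, v => v 0 < v 1

/-! ## The arithmetically definable reals -/

/-- Integers coded as natural numbers: `n ≥ 0` is coded by `2 n`, and `-n < 0` by `2 n + 1`. -/
def intCode : ℤ → ℕ
  | Int.ofNat n => 2 * n
  | Int.negSucc n => 2 * (n + 1) + 1

/-- Sequences of fractions `a / b` with integer numerator and positive integer denominator;
the pair `(a, b)` stands for `a / b` and need not be in lowest terms. -/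
abbrev FracSeq : Type := ℕ → ℤ × ℕ+

/-- The graph of `f` is definable in the standard model by a formula of the language of Peano
arithmetic, with finitely many natural numbers as parameters. -/
def FracSeq.IsDefinable (f : FracSeq) : Prop :=
  (Set.univ : Set ℕ).Definable languagePA
    {v : Fin 3 → ℕ | v 1 = intCode (f (v 0)).1 ∧ v 2 = ((f (v 0)).2 : ℕ)}

/-- Convergence in the sense of Cauchy: for all `m` there is `n` such that for all `k₁, k₂ > n`,
`m |a₁ / b₁ - a₂ / b₂| < 1`, where `a₁ / b₁` and `a₂ / b₂` are the entries at `k₁`, `k₂`. -/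
def FracSeq.IsConvergent (f : FracSeq) : Prop :=
  ∀ m : ℕ, ∃ n : ℕ, ∀ k₁ > n, ∀ k₂ > n,
    (m : ℤ) * |(f k₁).1 * (f k₂).2 - (f k₂).1 * (f k₁).2| < (f k₁).2 * (f k₂).2

/-- Two sequences of fractions are equivalent if their difference tends to zero: for all `m` there
is `n` such that `m |a / b - c / d| < 1` for the `k`-th entries `a / b`, `c / d`, for all `k > n`. -/
def FracSeq.Equivalent (f g : FracSeq) : Prop :=
  ∀ m : ℕ, ∃ n : ℕ, ∀ k > n,
    (m : ℤ) * |(f k).1 * (g k).2 - (g k).1 * (f k).2| < (f k).2 * (g k).2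

theorem FracSeq.Equivalent.refl (f : FracSeq) : f.Equivalent f := by
  intro m
  refine ⟨0, fun k _ => ?_⟩
  have h : (0 : ℤ) < (f k).2 := by exact_mod_cast (f k).2.pos
  rw [sub_self, abs_zero, mul_zero]
  positivity

theorem FracSeq.Equivalent.symm {f g : FracSeq} (h : f.Equivalent g) : g.Equivalent f := by
  intro m
  obtain ⟨n, hn⟩ := h m
  refine ⟨n, fun k hk => ?_⟩
  have := hn k hk
  rw [abs_sub_comm, mul_comm ((g k).2 : ℤ)]
  exact this

theorem FracSeq.Equivalent.trans {f g h : FracSeq} (hfg : f.Equivalent g)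
    (hgh : g.Equivalent h) : f.Equivalent h := by
  intro m
  obtain ⟨n₁, h₁⟩ := hfg (2 * m)
  obtain ⟨n₂, h₂⟩ := hgh (2 * m)
  refine ⟨max n₁ n₂, fun k hk => ?_⟩
  have e₁ := h₁ k (lt_of_le_of_lt (le_max_left _ _) hk)
  have e₂ := h₂ k (lt_of_le_of_lt (le_max_right _ _) hk)
  have hb : (0 : ℤ) < (f k).2 := by exact_mod_cast (f k).2.pos
  have hd : (0 : ℤ) < (g k).2 := by exact_mod_cast (g k).2.pos
  have hf : (0 : ℤ) < (h k).2 := by exact_mod_cast (h k).2.pos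
  generalize ((f k).2 : ℤ) = b at *
  generalize ((g k).2 : ℤ) = d at *
  generalize ((h k).2 : ℤ) = q at *
  generalize (f k).1 = a at *
  generalize (g k).1 = c at *
  generalize (h k).1 = p at *
  push_cast at e₁ e₂
  have key : d * |a * q - p * b| ≤ q * |a * d - c * b| + b * |c * q - p * d| := by
    have : d * (a * q - p * b) = q * (a * d - c * b) + b * (c * q - p * d) := by ring
    calc d * |a * q - p * b| = |d * (a * q - p * b)| := by rw [abs_mul, abs_of_pos hd]
      _ = |q * (a * d - c * b) + b * (c * q - p * d)| := by rw [this]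
      _ ≤ |q * (a * d - c * b)| + |b * (c * q - p * d)| := abs_add_le _ _
      _ = _ := by rw [abs_mul, abs_mul, abs_of_pos hf, abs_of_pos hb]
  have hm : (0 : ℤ) ≤ m := Int.natCast_nonneg m
  have s₁ := mul_lt_mul_of_pos_left e₁ hf
  have s₂ := mul_lt_mul_of_pos_left e₂ hb
  have s₃ := mul_le_mul_of_nonneg_left key (by positivity : (0 : ℤ) ≤ 2 * m)
  have : 2 * d * (m * |a * q - p * b|) < 2 * d * (b * q) := by nlinarith
  exact lt_of_mul_lt_mul_left this (by positivity)

/-- An `ℕ`-real: a definable convergent sequence of fractions. -/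
structure NReal where
  seq : FracSeq
  isDefinable : seq.IsDefinable
  isConvergent : seq.IsConvergent

instance NReal.setoid : Setoid NReal where
  r x y := x.seq.Equivalent y.seq
  iseqv :=
    { refl := fun x => FracSeq.Equivalent.refl x.seq
      symm := fun h => h.symm
      trans := fun h₁ h₂ => h₁.trans h₂ }

/-- The set `K_ℕ` of equivalence classes of `ℕ`-reals. -/
def KN : Type := Quotient NReal.setoid

/-- The sequence `Y` is an `ℕ`-real whose equivalence class is `η`. -/
def FracSeq.Represents (Y : FracSeq) (η : KN) : Prop :=
  ∃ y : NReal, y.seq = Y ∧ (Quotient.mk NReal.setoid y : KN) = η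

/-- `Y ∈ K_ℕ` for a sequence of fractions `Y`: it represents an element of `K_ℕ`. -/
def FracSeq.MemKN (Y : FracSeq) : Prop := ∃ η : KN, Y.Represents η

/-! ## Relative computability -/

/-- A sequence of fractions as a number-theoretic function: `k` is sent to a code of the pair
formed by the numerator and the denominator of the `k`-th entry. -/
def FracSeq.toOracle (Y : FracSeq) : ℕ → ℕ :=
  fun k => Nat.pair (intCode (Y k).1) ((Y k).2 : ℕ)

/-- `Y` is recursive in `X₁, …, Xₙ`: it is computable from the oracles `X₁, …, Xₙ`. -/
def FracSeq.RecursiveInSeqs {n : ℕ} (X : Fin n → FracSeq) (Y : FracSeq) : Prop :=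
  ComputableIn (Set.range fun i : Fin n => ((X i).toOracle : ℕ →. ℕ)) Y.toOracle

/-- Programs for partial functions recursive in a single oracle. -/
inductive OracleCode : Type
  | zero : OracleCode
  | succ : OracleCode
  | left : OracleCode
  | right : OracleCode
  | oracle : OracleCode
  | pair : OracleCode → OracleCode → OracleCode
  | comp : OracleCode → OracleCode → OracleCode
  | prec : OracleCode → OracleCode → OracleCode
  | rfind : OracleCode → OracleCode

/-- The partial function computed by a program with oracle `g`. -/
def OracleCode.eval (g : ℕ → ℕ) : OracleCode → ℕ →. ℕ
  | zero => fun _ => Part.some 0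
  | succ => fun n => Part.some (n + 1)
  | left => fun n => Part.some n.unpair.1
  | right => fun n => Part.some n.unpair.2
  | oracle => fun n => Part.some (g n)
  | pair c d => fun n => Nat.pair <$> c.eval g n <*> d.eval g n
  | comp c d => fun n => d.eval g n >>= c.eval g
  | prec c d => fun p =>
      Nat.rec (c.eval g p.unpair.1)
        (fun y ih => ih >>= fun i => d.eval g (Nat.pair p.unpair.1 (Nat.pair y i))) p.unpair.2
  | rfind c => fun a => Nat.rfind fun n => (fun m => decide (m = 0)) <$> c.eval g (Nat.pair a n)

/-- The Gödel number of a program. -/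
def OracleCode.godelNumber : OracleCode → ℕ
  | zero => 0
  | succ => 1
  | left => 2
  | right => 3
  | oracle => 4
  | pair c d => 4 * Nat.pair c.godelNumber d.godelNumber + 5
  | comp c d => 4 * Nat.pair c.godelNumber d.godelNumber + 6
  | prec c d => 4 * Nat.pair c.godelNumber d.godelNumber + 7
  | rfind c => 4 * c.godelNumber + 8

/-- The Turing jump of `g`: the set of all `e` such that the program with Gödel number `e` and
oracle `g` halts on input `e`. -/
def turingJump (g : ℕ → ℕ) : Set ℕ :=
  {e | ∃ c : OracleCode, c.godelNumber = e ∧ (c.eval g e).Dom}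

open Classical in
/-- The characteristic function of a set of natural numbers. -/
noncomputable def charFun (A : Set ℕ) : ℕ → ℕ := fun i => if i ∈ A then 1 else 0

/-- The set `Y⁽ⁿ⁺¹⁾`, the `(n+1)`-st iterated Turing jump of `Y`. -/
noncomputable def iteratedJumpSet (Y : FracSeq) : ℕ → Set ℕ
  | 0 => turingJump Y.toOracle
  | n + 1 => turingJump (charFun (iteratedJumpSet Y n))

/-- A set `A` of natural numbers as a real number with binary digits given by `A`: the sequence
of the partial sums `∑_{i < k} A(i) / 2 ^ (i + 1)`, the `k`-th written with denominator `2 ^ k`. -/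
noncomputable def binarySeq (A : Set ℕ) : FracSeq :=
  fun k => (((∑ i ∈ Finset.range k, charFun A i * 2 ^ (k - (i + 1)) : ℕ) : ℤ), 2 ^ k)

/-- The `n`-th Turing jump `Y⁽ⁿ⁾`, as a sequence of fractions: `Y⁽⁰⁾` is `Y`, and for `n > 0` the
set `Y⁽ⁿ⁾` is identified with the real number with these binary digits. -/
noncomputable def FracSeq.jump (Y : FracSeq) : ℕ → FracSeq
  | 0 => Y
  | n + 1 => binarySeq (iteratedJumpSet Y n)

/-!
A sequence of fractions is definable exactly when its oracle function is arithmetical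
(`FracSeq.isDefinable_iff`), so both claims reduce to two facts about an arithmetical oracle `g`:
every total function computable in `g` is arithmetical, and so is the halting set relative to `g`.

Both follow from the arithmetical definability of the universal relation "program number `e` with
oracle `g` sends `x` to `y`" (`OracleCode.arithPred_derivable`). A computation is witnessed by a
finite set of triples `(e, x, y)` in which every triple follows from others by one of the clauses
defining evaluation. Such derivations are sound, by induction on the program
(`OracleCode.mem_eval_of_justified`) and exist for every computation
(`OracleCode.derivable_of_mem_eval`). Gödel's beta function codes finite sets by numbers
(`exists_betaMem_iff`), which makes "there is a derivation" a first-order condition.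

For several oracles, the functions are joined into one oracle (`ArithFun.exists_join`,
`OracleCode.exists_eval_eq`). For the jumps, induction shows that every iterated jump is
arithmetical; the partial sums of its binary expansion satisfy a recurrence with arithmetical step
function, hence are arithmetical as well (`ArithFun.of_recurrence`), and they form a Cauchy
sequence because the digits after the `k`-th contribute less than `2 ^ (-k)`.
-/

section Arithmetical

open FirstOrder Set

/-! ### Arithmetical predicates and functions -/

/-- A predicate on assignments `v : α → ℕ` is arithmetical if it is first-order definable, with
parameters, in the standard model. The variables are indexed by an arbitrary type `α`; a quantifier
passes from `α` to `Option α`, the bound variable being `none`. -/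
def ArithPred {α : Type} (p : (α → ℕ) → Prop) : Prop :=
  (univ : Set ℕ).Definable languagePA {v | p v}

/-- A function of assignments is arithmetical if its graph is first-order definable, with
parameters, in the standard model. A function `f : ℕ → ℕ` is presented as
`fun v : Fin 1 → ℕ => f (v 0)`. -/
def ArithFun {α : Type} (f : (α → ℕ) → ℕ) : Prop :=
  (univ : Set ℕ).DefinableFun languagePA f

section Closure

variable {α β : Type}

namespace ArithPred

variable {p q : (α → ℕ) → Prop}

theorem and (hp : ArithPred p) (hq : ArithPred q) : ArithPred fun v => p v ∧ q v :=
  Definable.inter hp hq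

theorem or (hp : ArithPred p) (hq : ArithPred q) : ArithPred fun v => p v ∨ q v :=
  Definable.union hp hq

theorem not (hp : ArithPred p) : ArithPred fun v => ¬ p v :=
  Definable.compl hp

theorem of_iff (hp : ArithPred p) (h : ∀ v, q v ↔ p v) : ArithPred q := by
  rwa [show q = p from funext fun v => propext (h v)]

theorem imp (hp : ArithPred p) (hq : ArithPred q) : ArithPred fun v => p v → q v :=
  (hp.not.or hq).of_iff fun _ => imp_iff_not_or

theorem subst [Finite β] {p : (β → ℕ) → Prop} (hp : ArithPred p) {F : β → (α → ℕ) → ℕ}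
    (hF : ∀ i, ArithFun (F i)) : ArithPred fun v => p fun i => F i v :=
  Definable.preimage_map (F := fun v i => F i v) hF hp

theorem ex [Finite α] {p : (α → ℕ) → ℕ → Prop}
    (h : ArithPred fun w : Option α → ℕ => p (fun i => w (some i)) (w none)) :
    ArithPred fun v => ∃ x, p v x := by
  refine (congrArg _ ?_).mp (Definable.image_comp h some)
  ext v
  constructor
  · rintro ⟨w, hw, rfl⟩
    exact ⟨w none, hw⟩
  · rintro ⟨x, hx⟩
    exact ⟨fun o => o.elim x v, hx, rfl⟩

theorem all [Finite α] {p : (α → ℕ) → ℕ → Prop}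
    (h : ArithPred fun w : Option α → ℕ => p (fun i => w (some i)) (w none)) :
    ArithPred fun v => ∀ x, p v x :=
  (ArithPred.ex (p := fun v x => ¬ p v x) h.not).not.of_iff fun _ => by simp

end ArithPred

namespace ArithFun

variable {f g : (α → ℕ) → ℕ}

theorem var (i : α) : ArithFun fun v => v i := DefinableFun.proj _

theorem const (c : ℕ) : ArithFun fun _ : α → ℕ => c :=
  languagePA.definableFun_const α (mem_univ c)

theorem weaken [Finite α] (hf : ArithFun f) :
    ArithFun fun w : Option α → ℕ => f fun i => w (some i) :=
  DefinableFun.comp (g := fun w i => w (some i)) (fun i => var (some i)) hf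

theorem comp₂ {h : ℕ → ℕ → ℕ} (hh : ArithFun fun v : Fin 2 → ℕ => h (v 0) (v 1))
    (hf : ArithFun f) (hg : ArithFun g) : ArithFun fun v => h (f v) (g v) :=
  DefinableFun.comp (g := fun v => ![f v, g v])
    (fun i => by fin_cases i; exacts [hf, hg]) hh

theorem add (hf : ArithFun f) (hg : ArithFun g) : ArithFun fun v => f v + g v :=
  comp₂ (DefinableFun.of_empty (DefinableFun.fun_symbol (L := languagePA) PAFunc.add)) hf hg

theorem mul (hf : ArithFun f) (hg : ArithFun g) : ArithFun fun v => f v * g v :=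
  comp₂ (DefinableFun.of_empty (DefinableFun.fun_symbol (L := languagePA) PAFunc.mul)) hf hg

theorem eq (hf : ArithFun f) (hg : ArithFun g) : ArithPred fun v => f v = g v :=
  DefinableFun.ofPred_eq hf hg

theorem lt [Finite α] (hf : ArithFun f) (hg : ArithFun g) : ArithPred fun v => f v < g v :=
  (ArithPred.ex (p := fun v x => f v + x + 1 = g v)
    (((hf.weaken.add (var _)).add (const 1)).eq hg.weaken)).of_iff fun v =>
      ⟨fun h => ⟨g v - f v - 1, by omega⟩, fun ⟨x, h⟩ => by omega⟩

theorem ite {p : (α → ℕ) → Prop} [DecidablePred p] (hp : ArithPred p) (hf : ArithFun f)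
    (hg : ArithFun g) : ArithFun fun v => if p v then f v else g v :=
  DefinableFun.ite hp hf hg

theorem pair [Finite α] (hf : ArithFun f) (hg : ArithFun g) :
    ArithFun fun v => Nat.pair (f v) (g v) :=
  ite (hf.lt hg) ((hg.mul hg).add hf) (((hf.mul hf).add hf).add hg)

theorem of_graph (h : ArithPred fun w : Option α → ℕ => f (fun i => w (some i)) = w none) :
    ArithFun f := h

theorem comp₁ {h : ℕ → ℕ} (hh : ArithFun fun v : Fin 1 → ℕ => h (v 0)) (hf : ArithFun f) :
    ArithFun fun v => h (f v) :=
  DefinableFun.comp (g := fun v _ => f v) (fun _ => hf) hh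

end ArithFun

theorem arithPred_iff {p : (α → ℕ) → Prop} :
    ArithPred p ↔ (univ : Set ℕ).Definable languagePA {v | p v} := Iff.rfl

end Closure

-- Unfolded, an `ArithFun` is an `ArithPred` about its graph, so the closure lemmas for predicates
-- would unify with goals about functions.
attribute [irreducible] ArithPred ArithFun

/-! ### Coding finite sets of natural numbers -/

/-- The triple `(a, b, c)` codes a finite set by Gödel's beta function: its members are the
remainders of `a` modulo `(i + 1) * b + 1` for `i < c`, expressed with `+`, `*`, `<` alone. -/
def BetaMem (a b c n : ℕ) : Prop :=
  ∃ i, i < c ∧ ∃ q, a = ((i + 1) * b + 1) * q + n ∧ n < (i + 1) * b + 1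

theorem exists_betaMem_iff (T : Finset ℕ) : ∃ a b c, ∀ n, BetaMem a b c n ↔ n ∈ T := by
  refine ⟨(Nat.unbeta T.toList).unpair.1, (Nat.unbeta T.toList).unpair.2, T.toList.length,
    fun n => ?_⟩
  have key : ∀ a m : ℕ, (∃ q, a = (m + 1) * q + n ∧ n < m + 1) ↔ a % (m + 1) = n := by
    intro a m
    constructor
    · rintro ⟨q, rfl, h⟩
      rw [Nat.mul_add_mod, Nat.mod_eq_of_lt h]
    · rintro rfl
      exact ⟨a / (m + 1), (Nat.div_add_mod _ _).symm, Nat.mod_lt _ m.succ_pos⟩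
  simp only [BetaMem, key]
  rw [← Finset.mem_toList, List.mem_iff_getElem]
  constructor
  · rintro ⟨i, hi, h⟩
    exact ⟨i, hi, (Nat.beta_unbeta_coe T.toList ⟨i, hi⟩).symm.trans h⟩
  · rintro ⟨i, hi, h⟩
    exact ⟨i, hi, (Nat.beta_unbeta_coe T.toList ⟨i, hi⟩).trans h⟩

theorem ArithPred.betaMem {α : Type} {a b c n : (α → ℕ) → ℕ} (ha : ArithFun a)
    (hb : ArithFun b) (hc : ArithFun c) (hn : ArithFun n) :
    ArithPred fun v => BetaMem (a v) (b v) (c v) (n v) := by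
  -- With variables as arguments, all leaves of the formula are variables or constants.
  have h : ArithPred fun v : Fin 4 → ℕ => BetaMem (v 0) (v 1) (v 2) (v 3) := by
    unfold BetaMem
    apply_rules [ArithPred.ex, ArithPred.and, ArithFun.lt, ArithFun.eq, ArithFun.add, ArithFun.mul,
      ArithFun.var, ArithFun.const]
  exact h.subst (F := ![a, b, c, n]) fun i => by fin_cases i <;> assumption

-- Keeps `apply_rules` from looking inside a membership statement.
attribute [irreducible] BetaMem

/-! ### Evaluation of programs as derivability -/

namespace OracleCode

/-- `Justified g S e x y` says that "program number `e` sends `x` to `y`" follows, by one clause of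
the definition of evaluation with oracle `g`, from instances of this statement listed in `S`. -/
inductive Justified (g : ℕ → ℕ) (S : ℕ → ℕ → ℕ → Prop) : ℕ → ℕ → ℕ → Prop
  | zero {x} : Justified g S 0 x 0
  | succ {x} : Justified g S 1 x (x + 1)
  | left {y z} : Justified g S 2 (Nat.pair y z) y
  | right {y z} : Justified g S 3 (Nat.pair z y) y
  | oracle {x} : Justified g S 4 x (g x)
  | pair {c d x u w} : S c x u → S d x w → Justified g S (4 * Nat.pair c d + 5) x (Nat.pair u w)
  | comp {c d x u y} : S d x u → S c u y → Justified g S (4 * Nat.pair c d + 6) x y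
  | prec_zero {c d a y} : S c a y → Justified g S (4 * Nat.pair c d + 7) (Nat.pair a 0) y
  | prec_succ {c d a k i y} : S (4 * Nat.pair c d + 7) (Nat.pair a k) i →
      S d (Nat.pair a (Nat.pair k i)) y →
      Justified g S (4 * Nat.pair c d + 7) (Nat.pair a (k + 1)) y
  | rfind {c x y} : S c (Nat.pair x y) 0 → (∀ k, k < y → ∃ m, S c (Nat.pair x k) (m + 1)) →
      Justified g S (4 * c + 8) x y

/-- The clauses written as one first-order condition. -/
theorem justified_iff {g : ℕ → ℕ} {S : ℕ → ℕ → ℕ → Prop} {e x y : ℕ} : Justified g S e x y ↔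
    (e = 0 ∧ y = 0) ∨ (e = 1 ∧ y = x + 1) ∨ (e = 2 ∧ ∃ z, x = Nat.pair y z) ∨
    (e = 3 ∧ ∃ z, x = Nat.pair z y) ∨ (e = 4 ∧ y = g x) ∨
    (∃ c d u w, e = 4 * Nat.pair c d + 5 ∧ S c x u ∧ S d x w ∧ y = Nat.pair u w) ∨
    (∃ c d u, e = 4 * Nat.pair c d + 6 ∧ S d x u ∧ S c u y) ∨
    (∃ c d a, e = 4 * Nat.pair c d + 7 ∧ x = Nat.pair a 0 ∧ S c a y) ∨
    (∃ c d a k i, e = 4 * Nat.pair c d + 7 ∧ x = Nat.pair a (k + 1) ∧ S e (Nat.pair a k) i ∧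
      S d (Nat.pair a (Nat.pair k i)) y) ∨
    ∃ c, e = 4 * c + 8 ∧ S c (Nat.pair x y) 0 ∧ ∀ k, k < y → ∃ m, S c (Nat.pair x k) (m + 1) := by
  constructor
  · rintro (_ | _ | _ | _ | _ | ⟨h₁, h₂⟩ | ⟨h₁, h₂⟩ | h₁ | ⟨h₁, h₂⟩ | ⟨h₁, h₂⟩)
    · exact .inl ⟨rfl, rfl⟩
    · exact .inr <| .inl ⟨rfl, rfl⟩
    · exact .inr <| .inr <| .inl ⟨rfl, _, rfl⟩
    · exact .inr <| .inr <| .inr <| .inl ⟨rfl, _, rfl⟩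
    · exact .inr <| .inr <| .inr <| .inr <| .inl ⟨rfl, rfl⟩
    · exact .inr <| .inr <| .inr <| .inr <| .inr <| .inl ⟨_, _, _, _, rfl, h₁, h₂, rfl⟩
    · exact .inr <| .inr <| .inr <| .inr <| .inr <| .inr <| .inl ⟨_, _, _, rfl, h₁, h₂⟩
    · exact .inr <| .inr <| .inr <| .inr <| .inr <| .inr <| .inr <| .inl ⟨_, _, _, rfl, rfl, h₁⟩
    · exact .inr <| .inr <| .inr <| .inr <| .inr <| .inr <| .inr <| .inr <| .inl
        ⟨_, _, _, _, _, rfl, rfl, h₁, h₂⟩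
    · exact .inr <| .inr <| .inr <| .inr <| .inr <| .inr <| .inr <| .inr <| .inr ⟨_, rfl, h₁, h₂⟩
  · rintro (⟨rfl, rfl⟩ | ⟨rfl, rfl⟩ | ⟨rfl, _, rfl⟩ | ⟨rfl, _, rfl⟩ | ⟨rfl, rfl⟩ |
      ⟨_, _, _, _, rfl, h₁, h₂, rfl⟩ | ⟨_, _, _, rfl, h₁, h₂⟩ | ⟨_, _, _, rfl, rfl, h₁⟩ |
      ⟨_, _, _, _, _, rfl, rfl, h₁, h₂⟩ | ⟨_, rfl, h₁, h₂⟩)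
    exacts [.zero, .succ, .left, .right, .oracle, .pair h₁ h₂, .comp h₁ h₂, .prec_zero h₁,
      .prec_succ h₁ h₂, .rfind h₁ h₂]

theorem arithPred_justified {g : ℕ → ℕ} (hg : ArithFun fun v : Fin 1 → ℕ => g (v 0))
    {α : Type} {a b l e x y : (α → ℕ) → ℕ} (ha : ArithFun a) (hb : ArithFun b) (hl : ArithFun l)
    (he : ArithFun e) (hx : ArithFun x) (hy : ArithFun y) : ArithPred fun v =>
      Justified g (fun e x y => BetaMem (a v) (b v) (l v) (Nat.pair e (Nat.pair x y)))
        (e v) (x v) (y v) := by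
  -- A composition rule for `g`, which `apply_rules` takes from the context.
  have hg' : ∀ {β : Type} {f : (β → ℕ) → ℕ}, ArithFun f → ArithFun fun v => g (f v) :=
    fun hf => hg.comp₁ hf
  have h : ArithPred fun v : Fin 6 → ℕ =>
      Justified g (fun e x y => BetaMem (v 0) (v 1) (v 2) (Nat.pair e (Nat.pair x y)))
        (v 3) (v 4) (v 5) := by
    simp only [justified_iff]
    apply_rules (maxDepth := 1000) [ArithPred.ex, ArithPred.all, ArithPred.and, ArithPred.or,
      ArithPred.imp, ArithFun.lt, ArithFun.eq, ArithFun.add, ArithFun.mul, ArithFun.pair,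
      ArithPred.betaMem, ArithFun.var, ArithFun.const]
  exact h.subst (F := ![a, b, l, e, x, y]) fun i => by fin_cases i <;> assumption

theorem Justified.mono {g : ℕ → ℕ} {S T : ℕ → ℕ → ℕ → Prop} (h : ∀ e x y, S e x y → T e x y)
    {e x y : ℕ} (hS : Justified g S e x y) : Justified g T e x y := by
  cases hS with
  | zero => exact .zero
  | succ => exact .succ
  | left => exact .left
  | right => exact .right
  | oracle => exact .oracle
  | pair h₁ h₂ => exact .pair (h _ _ _ h₁) (h _ _ _ h₂)
  | comp h₁ h₂ => exact .comp (h _ _ _ h₁) (h _ _ _ h₂)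
  | prec_zero h₁ => exact .prec_zero (h _ _ _ h₁)
  | prec_succ h₁ h₂ => exact .prec_succ (h _ _ _ h₁) (h _ _ _ h₂)
  | rfind h₁ h₂ => exact .rfind (h _ _ _ h₁) fun k hk => (h₂ k hk).imp fun _ => h _ _ _

theorem mem_eval_pair {g : ℕ → ℕ} {c d : OracleCode} {x y : ℕ} :
    y ∈ (pair c d).eval g x ↔ ∃ u w, u ∈ c.eval g x ∧ w ∈ d.eval g x ∧ y = Nat.pair u w := by
  simp [eval, Seq.seq, eq_comm]

theorem mem_eval_comp {g : ℕ → ℕ} {c d : OracleCode} {x y : ℕ} :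
    y ∈ (comp c d).eval g x ↔ ∃ u, u ∈ d.eval g x ∧ y ∈ c.eval g u :=
  Part.mem_bind_iff

theorem eval_prec_zero {g : ℕ → ℕ} {c d : OracleCode} {a : ℕ} :
    (prec c d).eval g (Nat.pair a 0) = c.eval g a := by
  simp [eval]

theorem mem_eval_prec_succ {g : ℕ → ℕ} {c d : OracleCode} {a k y : ℕ} :
    y ∈ (prec c d).eval g (Nat.pair a (k + 1)) ↔
      ∃ i, i ∈ (prec c d).eval g (Nat.pair a k) ∧
        y ∈ d.eval g (Nat.pair a (Nat.pair k i)) := by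
  simp only [eval, Nat.unpair_pair]
  exact Part.mem_bind_iff

theorem mem_eval_rfind {g : ℕ → ℕ} {c : OracleCode} {x y : ℕ} :
    y ∈ (rfind c).eval g x ↔ 0 ∈ c.eval g (Nat.pair x y) ∧
      ∀ k, k < y → ∃ m, m + 1 ∈ c.eval g (Nat.pair x k) := by
  refine Nat.mem_rfind.trans (and_congr ?_ (forall_congr' fun k => imp_congr_right fun _ => ?_))
  · simp
  · simp only [Part.map_eq_map, Part.mem_map_iff, decide_eq_false_iff_not]
    constructor
    · rintro ⟨m, hm, h0⟩
      exact ⟨m - 1, by rwa [Nat.sub_add_cancel (Nat.pos_of_ne_zero h0)]⟩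
    · rintro ⟨m, hm⟩
      exact ⟨m + 1, hm, m.succ_ne_zero⟩

/-- Soundness: a predicate each of whose instances is justified by others is true of the evaluation
of programs. The predicate need not be finite or well-founded, since the justifications descend
along the program, and along the recursion variable for `prec`. -/
theorem mem_eval_of_justified {g : ℕ → ℕ} {S : ℕ → ℕ → ℕ → Prop}
    (hS : ∀ e x y, S e x y → Justified g S e x y) (c : OracleCode) :
    ∀ x y, S c.godelNumber x y → y ∈ c.eval g x := by
  -- The Gödel number leaves only the clauses for the outermost constructor of the program, and
  -- determines the Gödel numbers of its immediate subprograms.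
  induction c with
  | zero =>
    intro x y h
    have h := hS _ _ _ h
    generalize he : zero.godelNumber = e at h
    cases h <;> simp only [godelNumber] at he <;> try omega
    exact Part.mem_some _
  | succ =>
    intro x y h
    have h := hS _ _ _ h
    generalize he : succ.godelNumber = e at h
    cases h <;> simp only [godelNumber] at he <;> try omega
    exact Part.mem_some _
  | left =>
    intro x y h
    have h := hS _ _ _ h
    generalize he : left.godelNumber = e at h
    cases h <;> simp only [godelNumber] at he <;> try omega
    simp [eval]
  | right =>
    intro x y h
    have h := hS _ _ _ h
    generalize he : right.godelNumber = e at h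
    cases h <;> simp only [godelNumber] at he <;> try omega
    simp [eval]
  | oracle =>
    intro x y h
    have h := hS _ _ _ h
    generalize he : oracle.godelNumber = e at h
    cases h <;> simp only [godelNumber] at he <;> try omega
    exact Part.mem_some _
  | pair c d ihc ihd =>
    intro x y h
    have h := hS _ _ _ h
    generalize he : (pair c d).godelNumber = e at h
    cases h <;> simp only [godelNumber] at he <;> try omega
    rename_i c' d' u w h₁ h₂
    obtain ⟨rfl, rfl⟩ := Nat.pair_eq_pair.1
      (show Nat.pair c.godelNumber d.godelNumber = Nat.pair c' d' by omega)
    exact mem_eval_pair.2 ⟨u, w, ihc _ _ h₁, ihd _ _ h₂, rfl⟩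
  | comp c d ihc ihd =>
    intro x y h
    have h := hS _ _ _ h
    generalize he : (comp c d).godelNumber = e at h
    cases h <;> simp only [godelNumber] at he <;> try omega
    rename_i c' d' u h₁ h₂
    obtain ⟨rfl, rfl⟩ := Nat.pair_eq_pair.1
      (show Nat.pair c.godelNumber d.godelNumber = Nat.pair c' d' by omega)
    exact mem_eval_comp.2 ⟨u, ihd _ _ h₁, ihc _ _ h₂⟩
  | prec c d ihc ihd =>
    have key : ∀ n a y, S (prec c d).godelNumber (Nat.pair a n) y →
        y ∈ (prec c d).eval g (Nat.pair a n) := by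
      intro n
      induction n with
      | zero =>
        intro a y h
        have h := hS _ _ _ h
        generalize he : (prec c d).godelNumber = e at h
        generalize hx : Nat.pair a 0 = x at h
        cases h <;> simp only [godelNumber] at he <;> try omega
        · rename_i c' d' a' h₁
          obtain ⟨rfl, rfl⟩ := Nat.pair_eq_pair.1
            (show Nat.pair c.godelNumber d.godelNumber = Nat.pair c' d' by omega)
          obtain ⟨rfl, -⟩ := Nat.pair_eq_pair.1 hx
          rw [eval_prec_zero]
          exact ihc _ _ h₁
        · exact absurd (Nat.pair_eq_pair.1 hx).2 (Nat.succ_ne_zero _).symm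
      | succ n ih =>
        intro a y h
        have h := hS _ _ _ h
        generalize he : (prec c d).godelNumber = e at h
        generalize hx : Nat.pair a (n + 1) = x at h
        cases h <;> simp only [godelNumber] at he <;> try omega
        · exact absurd (Nat.pair_eq_pair.1 hx).2 n.succ_ne_zero
        · rename_i c' d' a' k i h₁ h₂
          obtain ⟨rfl, rfl⟩ := Nat.pair_eq_pair.1
            (show Nat.pair c.godelNumber d.godelNumber = Nat.pair c' d' by omega)
          obtain ⟨rfl, hn⟩ := Nat.pair_eq_pair.1 hx
          obtain rfl : n = k := Nat.succ.inj hn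
          exact mem_eval_prec_succ.2 ⟨i, ih _ _ h₁, ihd _ _ h₂⟩
    intro x y
    rw [← Nat.pair_unpair x]
    exact key _ _ _
  | rfind c ih =>
    intro x y h
    have h := hS _ _ _ h
    generalize he : (rfind c).godelNumber = e at h
    cases h <;> simp only [godelNumber] at he <;> try omega
    rename_i c' h₁ h₂
    obtain rfl : c.godelNumber = c' := by omega
    exact mem_eval_rfind.2 ⟨ih _ _ h₁, fun k hk => (h₂ k hk).imp fun m => ih _ _⟩

/-- A finite set `T` of codes `⟨e, ⟨x, y⟩⟩` is a derivation if each of its triples follows from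
triples of `T` by a clause of the definition of evaluation. -/
def Derivation (g : ℕ → ℕ) (T : Finset ℕ) : Prop :=
  ∀ e x y, Nat.pair e (Nat.pair x y) ∈ T →
    Justified g (fun e x y => Nat.pair e (Nat.pair x y) ∈ T) e x y

/-- The triple `(e, x, y)` occurs in some derivation. -/
def Derivable (g : ℕ → ℕ) (e x y : ℕ) : Prop :=
  ∃ T, Derivation g T ∧ Nat.pair e (Nat.pair x y) ∈ T

theorem Derivation.biUnion {g : ℕ → ℕ} {ι : Type} {s : Finset ι} {T : ι → Finset ℕ}
    (hT : ∀ i ∈ s, Derivation g (T i)) : Derivation g (s.biUnion T) := by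
  intro e x y h
  obtain ⟨i, hi, h⟩ := Finset.mem_biUnion.1 h
  exact (hT i hi e x y h).mono fun _ _ _ h => Finset.mem_biUnion.2 ⟨i, hi, h⟩

theorem Derivation.union {g : ℕ → ℕ} {T U : Finset ℕ} (hT : Derivation g T)
    (hU : Derivation g U) : Derivation g (T ∪ U) := by
  intro e x y h
  obtain h | h := Finset.mem_union.1 h
  · exact (hT e x y h).mono fun _ _ _ h => Finset.mem_union_left _ h
  · exact (hU e x y h).mono fun _ _ _ h => Finset.mem_union_right _ h

theorem Derivation.derivable {g : ℕ → ℕ} {T : Finset ℕ} (hT : Derivation g T) {e x y : ℕ}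
    (h : Justified g (fun e x y => Nat.pair e (Nat.pair x y) ∈ T) e x y) : Derivable g e x y := by
  refine ⟨insert (Nat.pair e (Nat.pair x y)) T, fun e' x' y' h' => ?_, Finset.mem_insert_self _ _⟩
  refine Justified.mono (S := fun e x y => Nat.pair e (Nat.pair x y) ∈ T)
    (fun _ _ _ => Finset.mem_insert_of_mem) ?_
  obtain heq | hmem := Finset.mem_insert.1 h'
  · obtain ⟨rfl, hxy⟩ := Nat.pair_eq_pair.1 heq
    obtain ⟨rfl, rfl⟩ := Nat.pair_eq_pair.1 hxy
    exact h
  · exact hT _ _ _ hmem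

/-- Derivability is closed under the clauses of evaluation: each clause has finitely many premises,
so the union of their derivations is a derivation containing all of them. -/
theorem Justified.derivable {g : ℕ → ℕ} {e x y : ℕ} (h : Justified g (Derivable g) e x y) :
    Derivable g e x y := by
  suffices ∃ T, Derivation g T ∧
      Justified g (fun e x y => Nat.pair e (Nat.pair x y) ∈ T) e x y from
    this.elim fun T hT => hT.1.derivable hT.2
  have hempty : Derivation g ∅ := fun e x y h => absurd h (Finset.notMem_empty _)
  cases h with
  | zero => exact ⟨∅, hempty, .zero⟩
  | succ => exact ⟨∅, hempty, .succ⟩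
  | left => exact ⟨∅, hempty, .left⟩
  | right => exact ⟨∅, hempty, .right⟩
  | oracle => exact ⟨∅, hempty, .oracle⟩
  | pair h₁ h₂ =>
    obtain ⟨⟨T, hT, h₁⟩, U, hU, h₂⟩ := And.intro h₁ h₂
    exact ⟨T ∪ U, hT.union hU,
      .pair (Finset.mem_union_left _ h₁) (Finset.mem_union_right _ h₂)⟩
  | comp h₁ h₂ =>
    obtain ⟨⟨T, hT, h₁⟩, U, hU, h₂⟩ := And.intro h₁ h₂
    exact ⟨T ∪ U, hT.union hU,
      .comp (Finset.mem_union_left _ h₁) (Finset.mem_union_right _ h₂)⟩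
  | prec_zero h₁ =>
    obtain ⟨T, hT, h₁⟩ := h₁
    exact ⟨T, hT, .prec_zero h₁⟩
  | prec_succ h₁ h₂ =>
    obtain ⟨⟨T, hT, h₁⟩, U, hU, h₂⟩ := And.intro h₁ h₂
    exact ⟨T ∪ U, hT.union hU,
      .prec_succ (Finset.mem_union_left _ h₁) (Finset.mem_union_right _ h₂)⟩
  | rfind h₁ h₂ =>
    obtain ⟨T, hT, h₁⟩ := h₁
    choose! m U hU hm using h₂
    refine ⟨T ∪ (Finset.range y).biUnion U,
      hT.union (Derivation.biUnion fun k hk => hU k (Finset.mem_range.1 hk)),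
      .rfind (Finset.mem_union_left _ h₁) fun k hk => ⟨m k, Finset.mem_union_right _ ?_⟩⟩
    exact Finset.mem_biUnion.2 ⟨k, Finset.mem_range.2 hk, hm k hk⟩

/-- Completeness: every computation has a finite derivation. -/
theorem derivable_of_mem_eval {g : ℕ → ℕ} (c : OracleCode) :
    ∀ x y, y ∈ c.eval g x → Derivable g c.godelNumber x y := by
  induction c with
  | zero =>
    intro x y h
    obtain rfl := Part.mem_some_iff.1 h
    exact Justified.zero.derivable
  | succ =>
    intro x y h
    obtain rfl := Part.mem_some_iff.1 h
    exact Justified.succ.derivable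
  | left =>
    intro x y h
    obtain rfl := Part.mem_some_iff.1 h
    have h : Justified g (Derivable g) 2 (Nat.pair x.unpair.1 x.unpair.2) x.unpair.1 := .left
    rw [Nat.pair_unpair] at h
    exact h.derivable
  | right =>
    intro x y h
    obtain rfl := Part.mem_some_iff.1 h
    have h : Justified g (Derivable g) 3 (Nat.pair x.unpair.1 x.unpair.2) x.unpair.2 := .right
    rw [Nat.pair_unpair] at h
    exact h.derivable
  | oracle =>
    intro x y h
    obtain rfl := Part.mem_some_iff.1 h
    exact Justified.oracle.derivable
  | pair c d ihc ihd =>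
    intro x y h
    obtain ⟨u, w, hu, hw, rfl⟩ := mem_eval_pair.1 h
    exact (Justified.pair (ihc _ _ hu) (ihd _ _ hw)).derivable
  | comp c d ihc ihd =>
    intro x y h
    obtain ⟨u, hu, h⟩ := mem_eval_comp.1 h
    exact (Justified.comp (ihd _ _ hu) (ihc _ _ h)).derivable
  | prec c d ihc ihd =>
    have key : ∀ n a y, y ∈ (prec c d).eval g (Nat.pair a n) →
        Derivable g (prec c d).godelNumber (Nat.pair a n) y := by
      intro n
      induction n with
      | zero =>
        intro a y h
        rw [eval_prec_zero] at h
        exact (Justified.prec_zero (ihc _ _ h)).derivable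
      | succ n ih =>
        intro a y h
        obtain ⟨i, hi, h⟩ := mem_eval_prec_succ.1 h
        exact (Justified.prec_succ (ih _ _ hi) (ihd _ _ h)).derivable
    intro x y
    rw [← Nat.pair_unpair x]
    exact key _ _ _
  | rfind c ih =>
    intro x y h
    obtain ⟨h₀, h⟩ := mem_eval_rfind.1 h
    exact (Justified.rfind (ih _ _ h₀) fun k hk => (h k hk).imp fun m => ih _ _).derivable

theorem derivable_godelNumber_iff {g : ℕ → ℕ} {c : OracleCode} {x y : ℕ} :
    Derivable g c.godelNumber x y ↔ y ∈ c.eval g x :=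
  ⟨fun ⟨_, hT, h⟩ => mem_eval_of_justified hT c x y h, derivable_of_mem_eval c x y⟩

theorem godelNumber_surjective : Function.Surjective godelNumber := by
  intro e
  induction e using Nat.strong_induction_on with
  | _ e ih =>
    obtain he | he := lt_or_ge e 5
    · interval_cases e
      exacts [⟨zero, rfl⟩, ⟨succ, rfl⟩, ⟨left, rfl⟩, ⟨right, rfl⟩, ⟨oracle, rfl⟩]
    · obtain ⟨q, rfl | rfl | rfl | rfl⟩ : ∃ q, e = 4 * q + 5 ∨ e = 4 * q + 6 ∨ e = 4 * q + 7 ∨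
        e = 4 * q + 8 := ⟨(e - 5) / 4, by omega⟩
      · obtain ⟨c, hc⟩ := ih q.unpair.1 (by have := q.unpair_left_le; omega)
        obtain ⟨d, hd⟩ := ih q.unpair.2 (by have := q.unpair_right_le; omega)
        exact ⟨pair c d, by simp [godelNumber, hc, hd]⟩
      · obtain ⟨c, hc⟩ := ih q.unpair.1 (by have := q.unpair_left_le; omega)
        obtain ⟨d, hd⟩ := ih q.unpair.2 (by have := q.unpair_right_le; omega)
        exact ⟨comp c d, by simp [godelNumber, hc, hd]⟩
      · obtain ⟨c, hc⟩ := ih q.unpair.1 (by have := q.unpair_left_le; omega)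
        obtain ⟨d, hd⟩ := ih q.unpair.2 (by have := q.unpair_right_le; omega)
        exact ⟨prec c d, by simp [godelNumber, hc, hd]⟩
      · obtain ⟨c, hc⟩ := ih q (by omega)
        exact ⟨rfind c, by simp [godelNumber, hc]⟩

/-- Quantification over finite sets of triples is replaced by quantification over the three numbers
coding such a set. From right to left, soundness turns the coded set into a true evaluation, and
completeness yields a derivation as a `Finset`. -/
theorem derivable_iff_exists_betaMem {g : ℕ → ℕ} {e x y : ℕ} : Derivable g e x y ↔
    ∃ a b l, (∀ e x y, BetaMem a b l (Nat.pair e (Nat.pair x y)) →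
      Justified g (fun e x y => BetaMem a b l (Nat.pair e (Nat.pair x y))) e x y) ∧
      BetaMem a b l (Nat.pair e (Nat.pair x y)) := by
  constructor
  · rintro ⟨T, hT, h⟩
    obtain ⟨a, b, l, hl⟩ := exists_betaMem_iff T
    exact ⟨a, b, l, by simpa only [hl] using ⟨hT, h⟩⟩
  · rintro ⟨a, b, l, hS, h⟩
    obtain ⟨c, rfl⟩ := godelNumber_surjective e
    exact derivable_of_mem_eval c x y (mem_eval_of_justified hS c x y h)

/-- The universal evaluation relation of an arithmetical oracle is arithmetical, uniformly in the
Gödel number of the program. -/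
theorem arithPred_derivable {g : ℕ → ℕ} (hg : ArithFun fun v : Fin 1 → ℕ => g (v 0))
    {α : Type} {e x y : (α → ℕ) → ℕ} (he : ArithFun e) (hx : ArithFun x) (hy : ArithFun y) :
    ArithPred fun v => Derivable g (e v) (x v) (y v) := by
  have h : ArithPred fun v : Fin 3 → ℕ => Derivable g (v 0) (v 1) (v 2) := by
    simp only [derivable_iff_exists_betaMem]
    apply_rules [ArithPred.ex, ArithPred.all, ArithPred.and, ArithPred.imp, ArithFun.pair,
      ArithPred.betaMem, arithPred_justified, ArithFun.var]
  exact h.subst (F := ![e, x, y]) fun i => by fin_cases i <;> assumption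

end OracleCode

/-! ### Functions computable in arithmetical oracles -/

namespace OracleCode

/-- A program for the constant function with value `n`. -/
def const : ℕ → OracleCode
  | 0 => zero
  | n + 1 => comp succ (const n)

theorem eval_const (g : ℕ → ℕ) (n x : ℕ) : (const n).eval g x = Part.some n := by
  induction n with
  | zero => rfl
  | succ n ih =>
    exact Part.eq_some_iff.2 (mem_eval_comp.2 ⟨n, ih ▸ Part.mem_some n, Part.mem_some _⟩)

theorem arithFun_of_eval {g f : ℕ → ℕ} (hg : ArithFun fun v : Fin 1 → ℕ => g (v 0))
    {c : OracleCode} {e : ℕ → ℕ} (he : ArithFun fun v : Fin 1 → ℕ => e (v 0))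
    (hc : ∀ x, c.eval g (e x) = Part.some (f x)) :
    ArithFun fun v : Fin 1 → ℕ => f (v 0) := by
  refine ArithFun.of_graph ((arithPred_derivable hg (ArithFun.const c.godelNumber)
    he.weaken (ArithFun.var none)).of_iff fun w => ?_)
  rw [derivable_godelNumber_iff, hc, Part.mem_some_iff, eq_comm]

/-- Finitely many oracles can be replaced by the single oracle `g` into which they are joined. -/
theorem exists_eval_eq {n : ℕ} {F : Fin n → ℕ → ℕ} {g : ℕ → ℕ}
    (hg : ∀ (i : Fin n) k, g (Nat.pair (i : ℕ) k) = F i k) {f : ℕ →. ℕ}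
    (hf : Nat.RecursiveIn (Set.range fun i => (F i : ℕ →. ℕ)) f) :
    ∃ c : OracleCode, c.eval g = f := by
  induction hf with
  | zero => exact ⟨zero, rfl⟩
  | succ => exact ⟨succ, rfl⟩
  | left => exact ⟨left, rfl⟩
  | right => exact ⟨right, rfl⟩
  | oracle f hf =>
    obtain ⟨i, rfl⟩ := hf
    refine ⟨comp oracle (pair (const i) (pair left right)), funext fun k => ?_⟩
    refine Part.eq_some_iff.2 (mem_eval_comp.2
      ⟨Nat.pair i k, mem_eval_pair.2 ⟨i, k, ?_, ?_, rfl⟩, ?_⟩)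
    · rw [eval_const]
      exact Part.mem_some _
    · exact mem_eval_pair.2 ⟨_, _, Part.mem_some _, Part.mem_some _, (Nat.pair_unpair k).symm⟩
    · exact Part.mem_some_iff.2 (hg i k).symm
  | pair _ _ ihf ihg =>
    obtain ⟨c, rfl⟩ := ihf
    obtain ⟨d, rfl⟩ := ihg
    exact ⟨pair c d, rfl⟩
  | comp _ _ ihf ihg =>
    obtain ⟨c, rfl⟩ := ihf
    obtain ⟨d, rfl⟩ := ihg
    exact ⟨comp c d, rfl⟩
  | prec _ _ ihf ihg =>
    obtain ⟨c, rfl⟩ := ihf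
    obtain ⟨d, rfl⟩ := ihg
    exact ⟨prec c d, rfl⟩
  | rfind _ ihf =>
    obtain ⟨c, rfl⟩ := ihf
    exact ⟨rfind c, rfl⟩

end OracleCode

theorem ArithFun.unpair_fst {α : Type} {f : (α → ℕ) → ℕ} (hf : ArithFun f) :
    ArithFun fun v => (f v).unpair.1 := by
  have h : ArithFun fun v : Fin 1 → ℕ => (v 0).unpair.1 :=
    ArithFun.of_graph (ArithPred.of_iff (ArithPred.ex
      (p := fun w : Option (Fin 1) → ℕ => fun y => Nat.pair (w none) y = w (some 0))
      (((ArithFun.var _).pair (ArithFun.var _)).eq (ArithFun.var _))) fun w =>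
      ⟨fun h => ⟨_, h ▸ Nat.pair_unpair _⟩, fun ⟨y, hy⟩ => by simp [← hy]⟩)
  exact h.comp₁ (h := fun z => z.unpair.1) hf

theorem ArithFun.unpair_snd {α : Type} {f : (α → ℕ) → ℕ} (hf : ArithFun f) :
    ArithFun fun v => (f v).unpair.2 := by
  have h : ArithFun fun v : Fin 1 → ℕ => (v 0).unpair.2 :=
    ArithFun.of_graph (ArithPred.of_iff (ArithPred.ex
      (p := fun w : Option (Fin 1) → ℕ => fun y => Nat.pair y (w none) = w (some 0))
      (((ArithFun.var _).pair (ArithFun.var _)).eq (ArithFun.var _))) fun w =>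
      ⟨fun h => ⟨_, h ▸ Nat.pair_unpair _⟩, fun ⟨y, hy⟩ => by simp [← hy]⟩)
  exact h.comp₁ (h := fun z => z.unpair.2) hf

theorem ArithFun.exists_join {n : ℕ} {F : Fin n → ℕ → ℕ}
    (hF : ∀ i, ArithFun fun v : Fin 1 → ℕ => F i (v 0)) :
    ∃ g : ℕ → ℕ, ArithFun (fun v : Fin 1 → ℕ => g (v 0)) ∧
      ∀ (i : Fin n) k, g (Nat.pair i k) = F i k := by
  induction n with
  | zero => exact ⟨fun _ => 0, ArithFun.const 0, fun i => i.elim0⟩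
  | succ n ih =>
    obtain ⟨g, hg, hgF⟩ := ih fun i => hF i.castSucc
    refine ⟨fun z => if z.unpair.1 = n then F (Fin.last n) z.unpair.2 else g z,
      ArithFun.ite ((ArithFun.var 0).unpair_fst.eq (ArithFun.const n))
        ((hF (Fin.last n)).comp₁ (ArithFun.var 0).unpair_snd) hg, fun i k => ?_⟩
    induction i using Fin.lastCases with
    | last => simp
    | cast i => simp [i.2.ne, ← hgF]

theorem ArithFun.of_computableIn {n : ℕ} {F : Fin n → ℕ → ℕ} {f : ℕ → ℕ}
    (hF : ∀ i, ArithFun fun v : Fin 1 → ℕ => F i (v 0))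
    (hf : ComputableIn (Set.range fun i => (F i : ℕ →. ℕ)) f) :
    ArithFun fun v : Fin 1 → ℕ => f (v 0) := by
  obtain ⟨g, hg, hgF⟩ := ArithFun.exists_join hF
  obtain ⟨c, hc⟩ := OracleCode.exists_eval_eq hgF (RecursiveIn.iff_nat.1 hf)
  exact OracleCode.arithFun_of_eval hg (ArithFun.var 0) fun x => congrFun hc x

/-- Arithmetical functions are closed under recursion: `f` is computed by one use of the primitive
recursion scheme from an oracle for the step function `h`. -/
theorem ArithFun.of_recurrence {f : ℕ → ℕ} {h : ℕ → ℕ → ℕ}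
    (hh : ArithFun fun v : Fin 2 → ℕ => h (v 0) (v 1)) (hf : ∀ k, f (k + 1) = h k (f k)) :
    ArithFun fun v : Fin 1 → ℕ => f (v 0) := by
  refine OracleCode.arithFun_of_eval (g := fun z => h z.unpair.2.unpair.1 z.unpair.2.unpair.2)
    (c := .prec (.const (f 0)) .oracle) (e := fun k => Nat.pair 0 k)
    (ArithFun.comp₂ hh (ArithFun.var 0).unpair_snd.unpair_fst
      (ArithFun.var 0).unpair_snd.unpair_snd)
    ((ArithFun.const 0).pair (ArithFun.var 0)) fun k => ?_
  induction k with
  | zero => rw [OracleCode.eval_prec_zero, OracleCode.eval_const]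
  | succ k ih =>
    refine Part.eq_some_iff.2 (OracleCode.mem_eval_prec_succ.2
      ⟨f k, ih ▸ Part.mem_some _, Part.mem_some_iff.2 ?_⟩)
    simp [hf]

/-! ### Turing jumps -/

theorem arithPred_turingJump {g : ℕ → ℕ} (hg : ArithFun fun v : Fin 1 → ℕ => g (v 0)) :
    ArithPred fun v : Fin 1 → ℕ => v 0 ∈ turingJump g := by
  refine ArithPred.of_iff (ArithPred.ex
    (p := fun v y => OracleCode.Derivable g (v 0) (v 0) y)
    (OracleCode.arithPred_derivable hg (ArithFun.var _) (ArithFun.var _) (ArithFun.var none)))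
    fun v => ?_
  constructor
  · rintro ⟨c, hc, h⟩
    rw [← hc] at h ⊢
    exact ⟨_, OracleCode.derivable_godelNumber_iff.2 (Part.get_mem h)⟩
  · rintro ⟨y, hy⟩
    obtain ⟨c, hc⟩ := OracleCode.godelNumber_surjective (v 0)
    rw [← hc] at hy
    exact ⟨c, hc, hc ▸ Part.dom_iff_mem.2 ⟨y, OracleCode.derivable_godelNumber_iff.1 hy⟩⟩

theorem ArithPred.charFun {A : Set ℕ} (hA : ArithPred fun v : Fin 1 → ℕ => v 0 ∈ A) :
    ArithFun fun v : Fin 1 → ℕ => charFun A (v 0) := by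
  classical
  exact ArithFun.ite hA (ArithFun.const 1) (ArithFun.const 0)

/-! ### Sequences of fractions -/

namespace FracSeq

/-- The graph of `Y` as a ternary relation and that of its oracle function differ only by pairing
numerator and denominator. -/
theorem isDefinable_iff {Y : FracSeq} :
    Y.IsDefinable ↔ ArithFun fun v : Fin 1 → ℕ => Y.toOracle (v 0) := by
  have : Y.IsDefinable ↔ ArithPred fun v : Fin 3 → ℕ =>
      v 1 = intCode (Y (v 0)).1 ∧ v 2 = ((Y (v 0)).2 : ℕ) := arithPred_iff.symm
  rw [this]
  constructor
  · intro h
    refine ArithFun.of_graph (ArithPred.of_iff (p := fun w : Option (Fin 1) → ℕ => ∃ a b,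
      (a = intCode (Y (w (some 0))).1 ∧ b = ((Y (w (some 0))).2 : ℕ)) ∧ Nat.pair a b = w none)
      ?_ fun w => ?_)
    · refine ArithPred.ex (ArithPred.ex (ArithPred.and ?_ ?_))
      · exact h.subst (F := ![fun w => w (some (some (some 0))), fun w => w (some none),
          fun w => w none]) fun i => by fin_cases i <;> exact ArithFun.var _
      · exact ((ArithFun.var _).pair (ArithFun.var _)).eq (ArithFun.var _)
    · simp [toOracle]
  · intro h
    refine (((ArithFun.var 1).pair (ArithFun.var 2)).eq (h.comp₁ (ArithFun.var 0))).of_iff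
      fun v => ?_
    exact Nat.pair_eq_pair.symm

theorem memKN_iff {Y : FracSeq} : Y.MemKN ↔ Y.IsDefinable ∧ Y.IsConvergent :=
  ⟨fun ⟨_, y, hy, _⟩ => hy ▸ ⟨y.isDefinable, y.isConvergent⟩,
    fun ⟨hd, hc⟩ => ⟨_, ⟨Y, hd, hc⟩, rfl, rfl⟩⟩

end FracSeq

theorem arithPred_iteratedJumpSet {Y : FracSeq} (hY : Y.IsDefinable) (n : ℕ) :
    ArithPred fun v : Fin 1 → ℕ => v 0 ∈ iteratedJumpSet Y n := by
  induction n with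
  | zero => exact arithPred_turingJump (FracSeq.isDefinable_iff.1 hY)
  | succ n ih => exact arithPred_turingJump ih.charFun

/-! ### Binary expansions -/

/-- The numerator of the `k`-th entry of `binarySeq A`. -/
noncomputable def binaryPartialSum (A : Set ℕ) (k : ℕ) : ℕ :=
  ∑ i ∈ Finset.range k, charFun A i * 2 ^ (k - (i + 1))

theorem binaryPartialSum_succ (A : Set ℕ) (k : ℕ) :
    binaryPartialSum A (k + 1) = 2 * binaryPartialSum A k + charFun A k := by
  rw [binaryPartialSum, Finset.sum_range_succ, binaryPartialSum, Finset.mul_sum]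
  congr 1
  · refine Finset.sum_congr rfl fun i hi => ?_
    have : k + 1 - (i + 1) = k - (i + 1) + 1 := by
      have := Finset.mem_range.1 hi
      omega
    rw [this, pow_succ]
    ring
  · simp

/-- The first `k + j` binary digits consist of the first `k` digits followed by a block of `j`
digits, which codes a number `r < 2 ^ j`. -/
theorem binaryPartialSum_add (A : Set ℕ) (k j : ℕ) :
    ∃ r < 2 ^ j, binaryPartialSum A (k + j) = 2 ^ j * binaryPartialSum A k + r := by
  induction j with
  | zero => exact ⟨0, by simp⟩
  | succ j ih =>
    obtain ⟨r, hr, h⟩ := ih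
    have h1 : charFun A (k + j) ≤ 1 := by
      unfold charFun
      split_ifs <;> simp
    refine ⟨2 * r + charFun A (k + j), ?_, ?_⟩
    · rw [pow_succ]
      omega
    · rw [← add_assoc, binaryPartialSum_succ, h]
      ring

theorem isDefinable_binarySeq {A : Set ℕ} (hA : ArithPred fun v : Fin 1 → ℕ => v 0 ∈ A) :
    (binarySeq A).IsDefinable := by
  have hsum : ArithFun fun v : Fin 1 → ℕ => binaryPartialSum A (v 0) :=
    ArithFun.of_recurrence (h := fun k s => 2 * s + charFun A k)
      (((ArithFun.const 2).mul (ArithFun.var 1)).add (hA.charFun.comp₁ (ArithFun.var 0)))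
      (binaryPartialSum_succ A)
  have hpow : ArithFun fun v : Fin 1 → ℕ => 2 ^ v 0 :=
    ArithFun.of_recurrence (h := fun _ s => 2 * s) ((ArithFun.const 2).mul (ArithFun.var 1))
      fun k => pow_succ' 2 k
  refine FracSeq.isDefinable_iff.2 ?_
  have : (binarySeq A).toOracle = fun k => Nat.pair (2 * binaryPartialSum A k) (2 ^ k) :=
    funext fun k => congrArg₂ Nat.pair rfl (PNat.pow_coe 2 k)
  rw [this]
  exact ((ArithFun.const 2).mul hsum).pair hpow

theorem isConvergent_binarySeq (A : Set ℕ) : (binarySeq A).IsConvergent := by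
  intro m
  -- The cross difference is `r * 2 ^ k` with `r < 2 ^ j`, and `m < k < 2 ^ k`.
  have key : ∀ k j, m < k → (m : ℤ) * |(binarySeq A k).1 * (binarySeq A (k + j)).2 -
      (binarySeq A (k + j)).1 * (binarySeq A k).2| <
        (binarySeq A k).2 * (binarySeq A (k + j)).2 := by
    intro k j hk
    obtain ⟨r, hr, h⟩ := binaryPartialSum_add A k j
    have hm : m < 2 ^ k := hk.trans k.lt_two_pow_self
    have h1 : ∀ k, (binarySeq A k).1 = (binaryPartialSum A k : ℤ) := fun _ => rfl
    have h2 : ∀ k, (((binarySeq A k).2 : ℕ) : ℤ) = 2 ^ k := fun k => by simp [binarySeq]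
    have habs : (binaryPartialSum A k : ℤ) * 2 ^ (k + j) -
        ((2 ^ j * binaryPartialSum A k + r : ℕ) : ℤ) * 2 ^ k = -((r : ℤ) * 2 ^ k) := by
      push_cast
      ring
    rw [h1, h1, h2, h2, h, habs, abs_neg, abs_of_nonneg (by positivity)]
    norm_cast
    calc m * (r * 2 ^ k) ≤ 2 ^ k * (r * 2 ^ k) := Nat.mul_le_mul_right _ hm.le
      _ < 2 ^ k * (2 ^ j * 2 ^ k) := by gcongr
      _ = 2 ^ k * 2 ^ (k + j) := by ring
  refine ⟨m, fun k₁ h₁ k₂ h₂ => ?_⟩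
  obtain h | h := le_total k₁ k₂
  · obtain ⟨j, rfl⟩ := Nat.exists_eq_add_of_le h
    exact key k₁ j h₁
  · obtain ⟨j, rfl⟩ := Nat.exists_eq_add_of_le h
    rw [abs_sub_comm, mul_comm (((binarySeq A (k₂ + j)).2 : ℕ) : ℤ)]
    exact key k₂ j h₂

end Arithmetical

theorem mainTheorem8 :
    (∀ (n : ℕ) (X : Fin n → KN) (x : Fin n → FracSeq), (∀ i, (x i).Represents (X i)) →
      ∀ Y : FracSeq, FracSeq.RecursiveInSeqs x Y → Y.IsConvergent → Y.MemKN) ∧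
    (∀ Y : FracSeq, Y.MemKN → ∀ n : ℕ, (Y.jump n).MemKN) := by
  refine ⟨fun n X x hx Y hrec hconv => FracSeq.memKN_iff.2 ⟨?_, hconv⟩, fun Y hY n => ?_⟩
  · exact FracSeq.isDefinable_iff.2 (ArithFun.of_computableIn (fun i =>
      FracSeq.isDefinable_iff.1 (FracSeq.memKN_iff.1 ⟨X i, hx i⟩).1) hrec)
  · cases n with
    | zero => exact hY
    | succ n =>
      exact FracSeq.memKN_iff.2 ⟨isDefinable_binarySeq
        (arithPred_iteratedJumpSet (FracSeq.memKN_iff.1 hY).1 n), isConvergent_binarySeq _⟩
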